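/- Let $h<k$ be relatively prime integers with $k\ge 1$, let $x\in\mathbb C$ with $|x|<1$, and let $$P(x,u)=\prod_{j=1}^\infty \frac{1}{1-xu^j}\quad(|u|<1),\qquad \mathrm{Li}_2(y)=\sum_{n=1}^\infty \frac{y^n}{n^2}\quad(|y|<1),$$ $$w_{h,k}=\frac1{2k}\ln(1-x^k)+\sum_{l\ge1,\;k\nmid l}\frac{x^l}{l}\,\frac{1}{e^{-2\pi i l h/k}-1},\qquad \Psi_k(z)=\frac{\mathrm{Li}_2(x^k)}{2\pi k^2}\,\frac1z ,$$ where $\ln$ is the principal logarithm; the series for $w_{h,k}$ converges absolutely. The double series $$Q_{h,k}(s)=\sum_{m\ge1}\sum_{l\ge1}\frac{x^l e^{2\pi i l m h/k}}{l}\,(lm)^{-s}$$ converges absolutely for $\Re(s)>1$ and extends to a holomorphic function on $\mathbb C\setminus\{1\}$, again denoted $Q_{h,k}$, with $\lim_{s\to1}(s-1)Q_{h,k}(s)=\mathrm{Li}_2(x^k)/k^2$ and $Q_{h,k}(0)=w_{h,k}$; if $x\neq0$, then $Q_{h,k}$ has a simple pole at $s=1$ (with residue $\mathrm{Li}_2(x^k)/k^2$).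 For every $z\in\mathbb C$ with $\Re(z)>0$ the product defining $P\left(x,e^{2\pi i(h/k+iz)}\right)$ converges, the integral $$j_{h,k}(z)=\frac1{2\pi i}\int_{-\frac34-i\infty}^{-\frac34+i\infty}Q_{h,k}(s)\,\Gamma(s)\,(2\pi z)^{-s}\,ds$$ (with the principal branch of the power) converges absolutely, and $$P\left(x,e^{2\pi i(h/k+iz)}\right)=e^{w_{h,k}}\,e^{\Psi_k(z)}\,e^{j_{h,k}(z)} .$$ -/

import Mathlib

noncomputable section

/-- The generating function `P(x,u) = ∏_{j ≥ 1} 1 / (1 - x u ^ j)`. -/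
def partitionGF (x u : ℂ) : ℂ := ∏' j : ℕ+, 1 / (1 - x * u ^ (j : ℕ))

/-- The dilogarithm `Li₂(y) = ∑_{n ≥ 1} y ^ n / n ^ 2`, used for `|y| < 1`. -/
def dilog (y : ℂ) : ℂ := ∑' n : ℕ+, y ^ (n : ℕ) / ((n : ℕ) : ℂ) ^ 2

/-- The point `e^{2πi(h/k + iz)}`. -/
def cuspPoint (h : ℤ) (k : ℕ) (z : ℂ) : ℂ :=
  Complex.exp (2 * Real.pi * Complex.I * ((h : ℂ) / (k : ℂ) + Complex.I * z))

/-- The term with indices `m = p.1`, `l = p.2` of the double series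
`∑_{m ≥ 1} ∑_{l ≥ 1} (x ^ l e^{2πi l m h / k} / l) (l m)^{-s}`. -/
def qTerm (x : ℂ) (h : ℤ) (k : ℕ) (s : ℂ) (p : ℕ+ × ℕ+) : ℂ :=
  x ^ (p.2 : ℕ) *
      Complex.exp (2 * Real.pi * Complex.I * ((p.2 : ℕ) : ℂ) * ((p.1 : ℕ) : ℂ) * (h : ℂ) / (k : ℂ)) /
      ((p.2 : ℕ) : ℂ) *
    (((p.2 : ℕ) : ℂ) * ((p.1 : ℕ) : ℂ)) ^ (-s)

/-- The term `(x ^ l / l) · 1 / (e^{-2πi l h / k} - 1)`. -/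
def wTerm (x : ℂ) (h : ℤ) (k : ℕ) (l : ℕ) : ℂ :=
  x ^ l / (l : ℂ) *
    (1 / (Complex.exp (-(2 * Real.pi * Complex.I * (l : ℂ) * (h : ℂ) / (k : ℂ))) - 1))

/-- `w_{h,k} = (1 / 2k) ln (1 - x ^ k) + ∑_{l ≥ 1, k ∤ l} (x ^ l / l) / (e^{-2πi l h / k} - 1)`.
The index `l = 0` does not occur because `k ∣ 0`. -/
def wConst (x : ℂ) (h : ℤ) (k : ℕ) : ℂ :=
  1 / (2 * (k : ℂ)) * Complex.log (1 - x ^ k) +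
    ∑' l : {l : ℕ // ¬ k ∣ l}, wTerm x h k l

/-- `Ψ_k(z) = Li₂(x ^ k) / (2 π k ^ 2) · 1 / z`. -/
def psiFun (x : ℂ) (k : ℕ) (z : ℂ) : ℂ :=
  dilog (x ^ k) / (2 * Real.pi * (k : ℂ) ^ 2) * (1 / z)

/-- The point `-3/4 + i t` of the line of integration. -/
def linePoint (t : ℝ) : ℂ := -3 / 4 + t * Complex.I

/-- The integrand `Q(s) Γ(s) (2πz)^{-s}`, with the principal power. -/
def jIntegrand (Q : ℂ → ℂ) (z s : ℂ) : ℂ :=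
  Q s * Complex.Gamma s * (2 * Real.pi * z) ^ (-s)

/-- `j(z) = (1 / 2πi) ∫ Q(s) Γ(s) (2πz)^{-s} ds` along the upward vertical line
`s = -3/4 + i t`, `ds = i dt`. -/
def jFun (Q : ℂ → ℂ) (z : ℂ) : ℂ :=
  1 / (2 * Real.pi * Complex.I) * ∫ t : ℝ, jIntegrand Q z (linePoint t) * Complex.I

end

/-!
Expanding the logarithm of the product and summing over `j` first, `log P (x, e^{2πi(h/k + iz)})`
is the sum over `l ≥ 1` of `x ^ l / l` times the kernel `1 / (e^{w - 2πia} - 1)` at `a = l h / k`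
and `w = 2π l z`. For `1 < Re s` the Mellin transform of the kernel along the ray through `w` is
`Γ(s) w^{-s} F(a, s)`, where `F(a, s) = ∑ e^{2πina} n^{-s}` is the periodic zeta function.

Near `w = 0` the kernel is `A / w + B + O(w)`. For `-1 < Re s < 0` the same formula therefore gives
the Mellin transform of the kernel minus `A / w + B`, and Mellin inversion writes the kernel as
`A / w + B` plus an integral over a vertical line in this strip. It also shows `F(a, 0) = B`.
Summed over `l`, the polar parts give `Ψ_k(z)`, the constants `B` give `w_{h,k}` and the integrals
give `j_{h,k}(z)`. Interchanging sum and integral is harmless because only finitely many phases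
`l h / k` occur modulo `1`.
-/

open Complex Filter Topology MeasureTheory Set Asymptotics HurwitzZeta

/-! ### Mellin transforms -/

section Mellin

theorem continuousOn_ofReal_cpow (s : ℂ) : ContinuousOn (fun t : ℝ => (t : ℂ) ^ s) (Ioi 0) :=
  fun t ht => (continuousAt_ofReal_cpow_const t s (Or.inr (ne_of_gt ht))).continuousWithinAt

theorem norm_mellin_le {f : ℝ → ℂ} (s : ℂ) :
    ‖mellin f s‖ ≤ ∫ t in Ioi (0 : ℝ), t ^ (s.re - 1) * ‖f t‖ := by
  refine (norm_integral_le_integral_norm _).trans_eq ?_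
  refine setIntegral_congr_fun measurableSet_Ioi fun t ht => ?_
  simp only [norm_smul, norm_cpow_eq_rpow_re_of_pos ht, sub_re, one_re]

variable {s w : ℂ}

theorem mellinConvergent_cexp_neg_mul (hs : 0 < s.re) (hw : 0 < w.re) :
    MellinConvergent (fun t => cexp (-(w * t))) s := by
  have hdom := integrableOn_rpow_mul_exp_neg_mul_rpow (p := 1) (s := s.re - 1) (b := w.re)
    (by linarith) one_pos hw
  refine Integrable.mono' hdom ?_ ?_
  · exact ((continuousOn_ofReal_cpow _).smul (by fun_prop)).aestronglyMeasurable measurableSet_Ioi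
  · filter_upwards [ae_restrict_mem measurableSet_Ioi] with t ht
    simp [norm_cpow_eq_rpow_re_of_pos ht, norm_exp]

theorem integral_norm_cpow_smul_cexp_neg_mul (hs : 0 < s.re) (hw : 0 < w.re) :
    ∫ t : ℝ in Ioi 0, ‖(t : ℂ) ^ (s - 1) • cexp (-(w * t))‖ =
      (1 / w.re) ^ s.re * Real.Gamma s.re := by
  rw [← Real.integral_rpow_mul_exp_neg_mul_Ioi hs hw]
  refine setIntegral_congr_fun measurableSet_Ioi fun t ht => ?_
  simp [norm_cpow_eq_rpow_re_of_pos ht, norm_exp]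

theorem differentiableAt_mellin_cexp_neg_mul (hs : 0 < s.re) (hw : 0 < w.re) :
    DifferentiableAt ℂ (fun v : ℂ => mellin (fun t => cexp (-(v * t))) s) w := by
  have hball : ∀ v ∈ Metric.ball w (w.re / 2), w.re / 2 < v.re := fun v hv => by
    have h := (abs_re_le_norm (v - w)).trans_lt (mem_ball_iff_norm.1 hv)
    rw [sub_re, abs_lt] at h
    linarith [h.1]
  have hdom := integrableOn_rpow_mul_exp_neg_mul_rpow (p := 1) (s := s.re) (b := w.re / 2)
    (by linarith) one_pos (by linarith)
  have hmeas : ∀ {g : ℝ → ℂ}, Continuous g → AEStronglyMeasurable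
      (fun t : ℝ => (t : ℂ) ^ (s - 1) • g t) (volume.restrict (Ioi 0)) := fun hg =>
    ((continuousOn_ofReal_cpow _).smul hg.continuousOn).aestronglyMeasurable measurableSet_Ioi
  refine (hasDerivAt_integral_of_dominated_loc_of_deriv_le
    (F := fun v (t : ℝ) => (t : ℂ) ^ (s - 1) • cexp (-(v * t)))
    (bound := fun t : ℝ => t ^ s.re * Real.exp (-(w.re / 2) * t ^ (1 : ℝ)))
    (F' := fun v t => (t : ℂ) ^ (s - 1) • (cexp (-(v * t)) * -t))
    (Metric.ball_mem_nhds w (half_pos hw)) (Eventually.of_forall fun v => hmeas (by fun_prop))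
    (mellinConvergent_cexp_neg_mul hs hw) (hmeas (by fun_prop)) ?_ hdom ?_).2.differentiableAt
  · filter_upwards [ae_restrict_mem measurableSet_Ioi] with t (ht : 0 < t) v hv
    have hexp : Real.exp (-(v * t)).re ≤ Real.exp (-(w.re / 2) * t) := by
      rw [Real.exp_le_exp, neg_re, re_mul_ofReal, neg_mul, neg_le_neg_iff]
      exact mul_le_mul_of_nonneg_right (hball v hv).le ht.le
    rw [norm_smul, norm_mul, norm_cpow_eq_rpow_re_of_pos ht, norm_exp, norm_neg, norm_real,
      Real.norm_of_nonneg ht.le, Real.rpow_one, sub_re, one_re, Real.rpow_sub_one ht.ne']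
    calc t ^ s.re / t * (Real.exp (-(v * t)).re * t) = t ^ s.re * Real.exp (-(v * t)).re := by
          field_simp
      _ ≤ _ := by gcongr
  · filter_upwards with t v _
    have h : HasDerivAt (fun v : ℂ => -(v * t)) (-t) v := by
      simpa using! ((hasDerivAt_id v).mul_const (t : ℂ)).neg
    exact h.cexp.const_smul ((t : ℂ) ^ (s - 1))

/- Mathlib has Euler's integral for real `w`; both sides are holomorphic in `w`. -/
theorem hasMellin_cexp_neg_mul (hs : 0 < s.re) (hw : 0 < w.re) :
    HasMellin (fun t => cexp (-(w * t))) s (Gamma s * w ^ (-s)) := by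
  refine ⟨mellinConvergent_cexp_neg_mul hs hw, ?_⟩
  have hopen : IsOpen {v : ℂ | 0 < v.re} := isOpen_lt continuous_const continuous_re
  have hleft : AnalyticOnNhd ℂ (fun v : ℂ => mellin (fun t => cexp (-(v * t))) s)
      {v : ℂ | 0 < v.re} :=
    DifferentiableOn.analyticOnNhd (fun v hv =>
      (differentiableAt_mellin_cexp_neg_mul hs hv).differentiableWithinAt) hopen
  have hright : AnalyticOnNhd ℂ (fun v : ℂ => Gamma s * v ^ (-s)) {v : ℂ | 0 < v.re} :=
    DifferentiableOn.analyticOnNhd (fun v hv =>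
      ((differentiableAt_id.cpow_const (Or.inl hv)).const_mul _).differentiableWithinAt) hopen
  have hreal : ∀ r : ℝ, 0 < r →
      mellin (fun t => cexp (-(r * t))) s = Gamma s * (r : ℂ) ^ (-s) := fun r hr => by
    simp only [mellin, smul_eq_mul]
    rw [Complex.integral_cpow_mul_exp_neg_mul_Ioi hs hr, one_div,
      inv_cpow _ _ (by rw [arg_ofReal_of_nonneg hr.le]; exact Real.pi_pos.ne), cpow_neg, mul_comm]
  have htend : Tendsto (fun r : ℝ => (r : ℂ)) (𝓝[≠] 1) (𝓝[≠] 1) :=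
    continuous_ofReal.continuousWithinAt.tendsto_nhdsWithin fun r hr => by simpa using hr
  have hfreq : ∃ᶠ r : ℝ in 𝓝[≠] 1, 0 < r :=
    (((eventually_gt_nhds (zero_lt_one' ℝ)).filter_mono nhdsWithin_le_nhds)).frequently
  exact hleft.eqOn_of_preconnected_of_frequently_eq hright
    (convex_halfSpace_re_gt 0).isPreconnected (z₀ := 1) (by simp)
    (htend.frequently (hfreq.mono hreal)) hw

theorem hasMellin_cpow_Ioi (a : ℂ) (hs : s.re + a.re < 0) :
    HasMellin (indicator (Ioi 1) (fun t : ℝ => (t : ℂ) ^ a)) s (-1 / (s + a)) := by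
  have hre : (s + a - 1).re < -1 := by simp; linarith
  have hEq : (fun t : ℝ => (t : ℂ) ^ (s - 1) • indicator (Ioi 1) (fun t : ℝ => (t : ℂ) ^ a) t) =
      indicator (Ioi 1) (fun t : ℝ => (t : ℂ) ^ (s + a - 1)) := by
    simp only [← indicator_smul]
    refine indicator_congr fun t (ht : 1 < t) => ?_
    have : (t : ℂ) ≠ 0 := ofReal_ne_zero.2 (by linarith)
    rw [smul_eq_mul, ← cpow_add _ _ this]
    ring_nf
  have hinter : Ioi (0 : ℝ) ∩ Ioi 1 = Ioi 1 := inter_eq_right.2 (Ioi_subset_Ioi zero_le_one)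
  constructor
  · rw [MellinConvergent, hEq, integrableOn_indicator_iff measurableSet_Ioi, inter_comm, hinter]
    exact integrableOn_Ioi_cpow_of_lt hre one_pos
  · rw [mellin, hEq, setIntegral_indicator measurableSet_Ioi, hinter,
      integral_Ioi_cpow_of_lt hre one_pos]
    simp

theorem hasSum_mellin_of_summable_integral_norm {ι : Type*} [Countable ι] {f : ι → ℝ → ℂ}
    {F : ℝ → ℂ} (hf : ∀ i, MellinConvergent (f i) s)
    (hsum : Summable fun i => ∫ t : ℝ in Ioi 0, ‖(t : ℂ) ^ (s - 1) • f i t‖)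
    (hF : ∀ t ∈ Ioi (0 : ℝ), HasSum (fun i => f i t) (F t)) :
    HasSum (fun i => mellin (f i) s) (mellin F s) := by
  convert! hasSum_integral_of_summable_integral_norm hf hsum using 1
  exact setIntegral_congr_fun measurableSet_Ioi fun t ht => ((hF t ht).const_smul _).tsum_eq.symm

end Mellin

/-! ### Continuation of Mellin transforms -/

theorem eq_of_meromorphicOn_of_eventuallyEq {f g : ℂ → ℂ} {U : Set ℂ} {z₀ z : ℂ}
    (hf : MeromorphicOn f U) (hg : MeromorphicOn g U) (hU : IsPreconnected U) (hz₀ : z₀ ∈ U)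
    (h : f =ᶠ[𝓝 z₀] g) (hz : z ∈ U) (hfz : ContinuousAt f z) (hgz : ContinuousAt g z) :
    f z = g z := by
  have htop : meromorphicOrderAt (f - g) z = ⊤ := by
    by_contra hne
    refine (hf.sub hg).meromorphicOrderAt_ne_top_of_isPreconnected hU hz hz₀ hne ?_
    rw [meromorphicOrderAt_eq_top_iff]
    filter_upwards [nhdsWithin_le_nhds h] with v hv using sub_eq_zero.2 hv
  have hev := meromorphicOrderAt_eq_top_iff.1 htop
  have hlim : Tendsto (f - g) (𝓝[≠] z) (𝓝 (f z - g z)) :=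
    ((hfz.sub hgz).tendsto).mono_left nhdsWithin_le_nhds
  exact sub_eq_zero.1 <| tendsto_nhds_unique hlim <|
    tendsto_const_nhds.congr' (hev.mono fun v hv => hv.symm)

/-- `f` is continuous on `(0, ∞)`, decays exponentially at `∞`, and satisfies
`f t = A / t + B + O(t)` as `t → 0⁺`; these properties determine the continuation of its Mellin
transform to `-1 < Re s`. -/
structure HasPolarExpansion (f : ℝ → ℂ) (A B : ℂ) : Prop where
  continuousOn : ContinuousOn f (Ioi 0)
  isBigO_atTop : ∃ c > 0, f =O[atTop] fun t => Real.exp (-c * t)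
  isBigO_zero : (fun t : ℝ => f t - (A / t + B)) =O[𝓝[>] 0] fun t => t

namespace HasPolarExpansion

/-- `f` with its polar part `A / t + B` removed on `(0, 1]` only. -/
noncomputable def truncation (f : ℝ → ℂ) (A B : ℂ) (t : ℝ) : ℂ :=
  f t - indicator (Ioc 0 1) (fun t : ℝ => A / t + B) t

theorem hasMellin_polar_Ioc (A B : ℂ) {s : ℂ} (hs : 1 < s.re) :
    HasMellin (indicator (Ioc 0 1) fun t : ℝ => A / t + B) s (A / (s - 1) + B / s) := by
  have hA := hasMellin_cpow_Ioc (-1) (s := s) (by simp; linarith)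
  have hB := hasMellin_cpow_Ioc 0 (s := s) (by simp; linarith)
  have hA' := hasMellin_const_smul hA.1 A
  have hB' := hasMellin_const_smul hB.1 B
  have h := hasMellin_add hA'.1 hB'.1
  rw [hA'.2, hB'.2, hA.2, hB.2] at h
  convert! h using 1
  · ext t
    by_cases ht : t ∈ Ioc (0 : ℝ) 1 <;> simp [ht, cpow_neg_one, div_eq_mul_inv]
  · simp [div_eq_mul_inv, sub_eq_add_neg]

theorem hasMellin_polar_Ioi (A B : ℂ) {s : ℂ} (hs : s.re < 0) :
    HasMellin (indicator (Ioi 1) fun t : ℝ => A / t + B) s (-(A / (s - 1) + B / s)) := by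
  have hA := hasMellin_cpow_Ioi (-1) (s := s) (by simp; linarith)
  have hB := hasMellin_cpow_Ioi 0 (s := s) (by simp; linarith)
  have hA' := hasMellin_const_smul hA.1 A
  have hB' := hasMellin_const_smul hB.1 B
  have h := hasMellin_add hA'.1 hB'.1
  rw [hA'.2, hB'.2, hA.2, hB.2] at h
  convert! h using 1
  · ext t
    by_cases ht : t ∈ Ioi (1 : ℝ) <;> simp [ht, cpow_neg_one, div_eq_mul_inv]
  · simp [div_eq_mul_inv, sub_eq_add_neg]
    ring

variable {f : ℝ → ℂ} {A B s : ℂ}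

theorem locallyIntegrableOn_truncation (hf : HasPolarExpansion f A B) :
    LocallyIntegrableOn (truncation f A B) (Ioi 0) := by
  refine (hf.continuousOn.locallyIntegrableOn measurableSet_Ioi).sub ?_
  have hpolar : ContinuousOn (fun t : ℝ => A / t + B) (Ioi 0) := fun t ht =>
    ContinuousAt.continuousWithinAt
      (by fun_prop (disch := exact ofReal_ne_zero.2 (ne_of_gt ht)))
  intro t ht
  obtain ⟨u, hu, h⟩ := hpolar.locallyIntegrableOn (μ := volume) measurableSet_Ioi t ht
  exact ⟨u, hu, h.indicator measurableSet_Ioc⟩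

theorem truncation_eventuallyEq_atTop : truncation f A B =ᶠ[atTop] f := by
  filter_upwards [eventually_gt_atTop 1] with t ht
  simp [truncation, ht]

theorem truncation_isBigO_zero (hf : HasPolarExpansion f A B) :
    truncation f A B =O[𝓝[>] 0] fun t => t ^ (-(-1) : ℝ) := by
  simp only [neg_neg, Real.rpow_one]
  refine hf.isBigO_zero.congr' ?_ EventuallyEq.rfl
  filter_upwards [Ioc_mem_nhdsGT (zero_lt_one' ℝ)] with t ht
  rw [truncation, indicator_of_mem ht]

theorem mellinConvergent_truncation (hf : HasPolarExpansion f A B) (hs : -1 < s.re) :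
    MellinConvergent (truncation f A B) s := by
  obtain ⟨c, hc, hO⟩ := hf.isBigO_atTop
  exact mellinConvergent_of_isBigO_rpow_exp hc hf.locallyIntegrableOn_truncation
    (truncation_eventuallyEq_atTop.trans_isBigO hO) hf.truncation_isBigO_zero hs

theorem differentiableAt_mellin_truncation (hf : HasPolarExpansion f A B) (hs : -1 < s.re) :
    DifferentiableAt ℂ (mellin (truncation f A B)) s := by
  obtain ⟨c, hc, hO⟩ := hf.isBigO_atTop
  exact mellin_differentiableAt_of_isBigO_rpow_exp hc hf.locallyIntegrableOn_truncation
    (truncation_eventuallyEq_atTop.trans_isBigO hO) hf.truncation_isBigO_zero hs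

theorem mellin_eq (hf : HasPolarExpansion f A B) (hs : 1 < s.re) :
    mellin f s = mellin (truncation f A B) s + (A / (s - 1) + B / s) := by
  have hpolar := hasMellin_polar_Ioc A B hs
  rw [← hpolar.2,
    ← (hasMellin_add (hf.mellinConvergent_truncation (by linarith)) hpolar.1).2]
  simp [truncation]

section Continuation

variable {M : ℂ → ℂ}

theorem continuation_eq (hf : HasPolarExpansion f A B) (hM : MeromorphicOn M {s | -1 < s.re})
    (hMf : ∀ s, 1 < s.re → M s = mellin f s) (hs : -1 < s.re) (hs0 : s ≠ 0) (hs1 : s ≠ 1)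
    (hMs : ContinuousAt M s) :
    M s = mellin (truncation f A B) s + (A / (s - 1) + B / s) := by
  have hopen : IsOpen {s : ℂ | -1 < s.re} := isOpen_lt continuous_const continuous_re
  have htrunc : AnalyticOnNhd ℂ (mellin (truncation f A B)) {s | -1 < s.re} :=
    DifferentiableOn.analyticOnNhd (fun s hs =>
      (hf.differentiableAt_mellin_truncation hs).differentiableWithinAt) hopen
  have hs1' : s - 1 ≠ 0 := sub_ne_zero.2 hs1
  refine eq_of_meromorphicOn_of_eventuallyEq (z₀ := 2)
    (g := fun s => mellin (truncation f A B) s + (A / (s - 1) + B / s)) hM ?_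
    (convex_halfSpace_re_gt (-1)).isPreconnected (by norm_num) ?_ hs hMs
    ((htrunc s hs).continuousAt.add (by fun_prop (disch := assumption)))
  · exact htrunc.meromorphicOn.add fun s _ => by fun_prop
  · have : ∀ᶠ s : ℂ in 𝓝 2, 1 < s.re :=
      (isOpen_lt continuous_const continuous_re).mem_nhds (by simp)
    filter_upwards [this] with s hs using (hMf s hs).trans (hf.mellin_eq hs)

theorem hasMellin_sub_polar (hf : HasPolarExpansion f A B)
    (hM : MeromorphicOn M {s | -1 < s.re}) (hMf : ∀ s, 1 < s.re → M s = mellin f s)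
    (hs : -1 < s.re) (hs0 : s.re < 0) (hMs : ContinuousAt M s) :
    HasMellin (fun t => f t - (A / t + B)) s (M s) := by
  have hpolar := hasMellin_polar_Ioi A B hs0
  have h := hasMellin_sub (hf.mellinConvergent_truncation hs) hpolar.1
  have hEq : EqOn (fun t : ℝ => (t : ℂ) ^ (s - 1) • (truncation f A B t -
      indicator (Ioi 1) (fun t : ℝ => A / t + B) t))
      (fun t : ℝ => (t : ℂ) ^ (s - 1) • (f t - (A / t + B))) (Ioi 0) := by
    intro t (ht : 0 < t)
    rcases le_or_gt t 1 with h | h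
    · simp [truncation, ht, h]
    · simp [truncation, h]
  refine ⟨h.1.congr_fun hEq measurableSet_Ioi, ?_⟩
  rw [mellin, ← setIntegral_congr_fun measurableSet_Ioi hEq, ← mellin, h.2, hpolar.2,
    hf.continuation_eq hM hMf hs (by rintro rfl; simp at hs0) (by rintro rfl; norm_num at hs0) hMs,
    sub_neg_eq_add]

theorem tendsto_mul_continuation (hf : HasPolarExpansion f A B)
    (hM : MeromorphicOn M {s | -1 < s.re}) (hMf : ∀ s, 1 < s.re → M s = mellin f s) :
    Tendsto (fun s => s * M s) (𝓝[≠] 0) (𝓝 B) := by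
  have hmem : ∀ᶠ s : ℂ in 𝓝[≠] 0, -1 < s.re ∧ s ≠ 1 := nhdsWithin_le_nhds <|
    ((isOpen_lt continuous_const continuous_re).inter isOpen_ne).mem_nhds (by simp)
  have hlim : ContinuousAt
      (fun s : ℂ => s * (mellin (truncation f A B) s + A / (s - 1)) + B) 0 := by
    have := (hf.differentiableAt_mellin_truncation (s := 0) (by simp)).continuousAt
    have hne : (0 : ℂ) - 1 ≠ 0 := by simp
    fun_prop (disch := assumption)
  refine Tendsto.congr' ?_
    (by simpa using hlim.tendsto.mono_left (nhdsWithin_le_nhds (s := {0}ᶜ)))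
  filter_upwards [hmem, (hM 0 (by simp)).eventually_analyticAt, self_mem_nhdsWithin]
    with s hs hMs (hs0 : s ≠ 0)
  rw [hf.continuation_eq hM hMf hs.1 hs0 hs.2 hMs.continuousAt]
  field_simp
  ring

end Continuation

end HasPolarExpansion

/-! ### The kernel `1 / (e^{w - 2πia} - 1)` -/

theorem hasSum_pnat_geometric {K : Type*} [NormedDivisionRing K] {q : K} (hq : ‖q‖ < 1) :
    HasSum (fun n : ℕ+ => q ^ (n : ℕ)) (q / (1 - q)) := by
  rw [hasSum_pnat_iff_hasSum_succ (f := fun n => q ^ n)]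
  simpa only [pow_succ', div_eq_mul_inv] using (hasSum_geometric_of_norm_lt_one hq).mul_left q

/-- The kernel `1 / (e^{w - 2πia} - 1)`, i.e. the sum of `e^{2πina} e^{-nw}` over `n ≥ 1` when
`0 < Re w`. The phase `a` is taken in `ℝ / ℤ`. -/
noncomputable def expKernel (a : UnitAddCircle) (w : ℂ) : ℂ :=
  1 / (((-a).toCircle : ℂ) * cexp w - 1)

open Classical in
/-- The residue of `expKernel a` at `0`. -/
noncomputable def expKernelResidue (a : UnitAddCircle) : ℂ := if a = 0 then 1 else 0

open Classical in
/-- The constant term of the Laurent expansion of `expKernel a` at `0`. -/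
noncomputable def expKernelConst (a : UnitAddCircle) : ℂ :=
  if a = 0 then -1 / 2 else expKernel a 0

section ExpKernel

variable {w : ℂ} (a : UnitAddCircle)

theorem expKernel_eq_div (w : ℂ) :
    expKernel a w = a.toCircle * cexp (-w) / (1 - a.toCircle * cexp (-w)) := by
  have hc := (a.toCircle).coe_ne_zero
  have he := exp_ne_zero w
  have h : (1 : ℂ) - a.toCircle * cexp (-w) =
      a.toCircle * cexp (-w) * ((-a).toCircle * cexp w - 1) := by
    rw [AddCircle.toCircle_neg, Circle.coe_inv, exp_neg]
    field_simp
  rw [expKernel, h, div_mul_eq_div_div, div_self (mul_ne_zero hc (exp_ne_zero _))]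

theorem hasSum_expKernel (hw : 0 < w.re) :
    HasSum (fun n : ℕ+ => (((n : ℕ) • a).toCircle : ℂ) * cexp (-(n * w))) (expKernel a w) := by
  have hq : ‖(a.toCircle : ℂ) * cexp (-w)‖ < 1 := by
    simpa [Circle.norm_coe, norm_exp] using hw
  rw [expKernel_eq_div]
  refine (hasSum_pnat_geometric hq).congr_fun fun n => ?_
  rw [mul_pow, AddCircle.toCircle_nsmul, Circle.coe_pow, ← exp_nat_mul, mul_neg]

theorem norm_expKernel_le (hw : 0 < w.re) : ‖expKernel a w‖ ≤ 1 / (Real.exp w.re - 1) := by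
  rw [expKernel, norm_div, norm_one]
  refine one_div_le_one_div_of_le (sub_pos.2 (Real.one_lt_exp_iff.2 hw)) ?_
  simpa [Circle.norm_coe, norm_exp] using norm_sub_norm_le (((-a).toCircle : ℂ) * cexp w) 1

theorem continuousAt_expKernel (hw : 0 < w.re) : ContinuousAt (expKernel a) w := by
  refine continuousAt_const.div (by fun_prop) (sub_ne_zero.2 fun h => ?_)
  have h' := congrArg norm h
  simp [Circle.norm_coe, norm_exp, hw.ne'] at h'

theorem expKernel_ray_isBigO_exp (hw : 0 < w.re) :
    (fun t : ℝ => expKernel a (t * w)) =O[atTop] fun t => Real.exp (-w.re * t) := by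
  refine IsBigO.of_bound 2 ?_
  filter_upwards [eventually_ge_atTop (1 / w.re), eventually_gt_atTop 0] with t ht ht0
  have htw : 1 ≤ t * w.re := by rwa [div_le_iff₀ hw] at ht
  have hexp : 2 ≤ Real.exp (t * w.re) := by linarith [Real.add_one_le_exp (t * w.re)]
  refine (norm_expKernel_le a (by rw [re_ofReal_mul]; positivity)).trans ?_
  rw [re_ofReal_mul, Real.norm_eq_abs, Real.abs_exp, neg_mul, Real.exp_neg, mul_comm w.re t,
    ← div_eq_mul_inv, div_le_div_iff₀ (by linarith) (by positivity)]
  linarith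

theorem one_div_exp_sub_one_isBigO :
    (fun w : ℂ => 1 / (cexp w - 1) - (1 / w + -1 / 2)) =O[𝓝[≠] 0] fun w => w := by
  have hmono : 𝓝[≠] (0 : ℂ) ≤ 𝓝 0 := nhdsWithin_le_nhds
  have htwo : (fun w => cexp w - 1 - w) =O[𝓝[≠] 0] fun w => w ^ 2 := by
    simpa [Finset.sum_range_succ, sub_sub] using (exp_sub_sum_range_isBigO_pow 2).mono hmono
  have hthree : (fun w => cexp w - 1 - w - w ^ 2 / 2) =O[𝓝[≠] 0] fun w => w ^ 3 := by
    simpa [Finset.sum_range_succ, sub_sub, add_assoc] using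
      (exp_sub_sum_range_isBigO_pow 3).mono hmono
  have hnum : (fun w => 1 / 2 * (w * (cexp w - 1 - w)) - (cexp w - 1 - w - w ^ 2 / 2))
      =O[𝓝[≠] 0] fun w => w ^ 3 :=
    ((((isBigO_refl _ _).mul htwo).congr_right fun w => by ring).const_mul_left (1 / 2)).sub hthree
  have hden : (fun w : ℂ => w) =O[𝓝[≠] 0] fun w => cexp w - 1 :=
    (htwo.trans_isLittleO ((isLittleO_pow_id one_lt_two).mono hmono)).right_isBigO_add.congr_right
      fun w => by ring
  have hne : ∀ᶠ w : ℂ in 𝓝[≠] 0, cexp w - 1 ≠ 0 := by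
    simpa [sub_ne_zero] using (hasDerivAt_exp 0).eventually_ne (exp_ne_zero 0) (c := 1)
  have hpow : (fun w : ℂ => w ^ 3) =O[𝓝[≠] 0] fun w => w * (w * (cexp w - 1)) :=
    ((isBigO_refl (fun w : ℂ => w) _).mul ((isBigO_refl (fun w : ℂ => w) _).mul hden)).congr_left
      fun w => by ring
  refine ((hnum.trans hpow).mul (isBigO_refl (fun w => (w * (cexp w - 1))⁻¹) _)).congr' ?_ ?_
  · filter_upwards [hne, self_mem_nhdsWithin] with w hE (hw : w ≠ 0)
    field_simp
    ring
  · filter_upwards [hne, self_mem_nhdsWithin] with w hE (hw : w ≠ 0)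
    exact mul_inv_cancel_right₀ (mul_ne_zero hw hE) w

theorem expKernel_isBigO_zero :
    (fun w : ℂ => expKernel a w - (expKernelResidue a / w + expKernelConst a))
      =O[𝓝[≠] 0] fun w => w := by
  by_cases ha : a = 0
  · simpa [expKernel, expKernelResidue, expKernelConst, ha] using one_div_exp_sub_one_isBigO
  · have hne : ((-a).toCircle : ℂ) * cexp 0 - 1 ≠ 0 := by
      rw [exp_zero, mul_one, sub_ne_zero]
      rw [Ne, Circle.coe_eq_one, ← AddCircle.toCircle_zero]
      exact fun h => ha (neg_eq_zero.1 (AddCircle.injective_toCircle one_ne_zero h))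
    have hd : DifferentiableAt ℂ (expKernel a) 0 :=
      (differentiableAt_const _).div (by fun_prop) hne
    simpa [expKernelResidue, expKernelConst, ha] using hd.isBigO_sub.mono nhdsWithin_le_nhds

theorem hasPolarExpansion_expKernel (hw : 0 < w.re) :
    HasPolarExpansion (fun t : ℝ => expKernel a (t * w)) (expKernelResidue a / w)
      (expKernelConst a) where
  continuousOn t (ht : 0 < t) := by
    have htw : 0 < ((t : ℂ) * w).re := by
      rw [re_ofReal_mul]
      positivity
    exact (ContinuousAt.comp (f := fun t : ℝ => (t : ℂ) * w) (continuousAt_expKernel a htw)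
      (by fun_prop)).continuousWithinAt
  isBigO_atTop := ⟨w.re, hw, expKernel_ray_isBigO_exp a hw⟩
  isBigO_zero := by
    have htend : Tendsto (fun t : ℝ => (t : ℂ) * w) (𝓝[>] 0) (𝓝[≠] 0) := by
      refine tendsto_nhdsWithin_of_tendsto_nhds_of_eventually_within _ ?_ ?_
      · have : Continuous fun t : ℝ => (t : ℂ) * w := by fun_prop
        simpa using (this.tendsto 0).mono_left nhdsWithin_le_nhds
      · filter_upwards [self_mem_nhdsWithin] with t (ht : 0 < t)
        exact mul_ne_zero (ofReal_ne_zero.2 ht.ne') (ne_zero_of_re_pos hw)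
    refine (((expKernel_isBigO_zero a).comp_tendsto htend).congr_left fun t => ?_).trans ?_
    · simp only [Function.comp_apply, mul_comm (t : ℂ) w, div_div]
    · refine IsBigO.of_bound ‖w‖ (Eventually.of_forall fun t => ?_)
      simp [mul_comm]

end ExpKernel

/-! ### The periodic zeta function and Mellin inversion -/

theorem ofReal_mul_cpow {r : ℝ} (hr : 0 < r) {w : ℂ} (hw : w ≠ 0) (s : ℂ) :
    ((r : ℂ) * w) ^ s = (r : ℂ) ^ s * w ^ s := by
  have hr' : (r : ℂ) ≠ 0 := ofReal_ne_zero.2 hr.ne'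
  rw [cpow_def_of_ne_zero (mul_ne_zero hr' hw), cpow_def_of_ne_zero hr', cpow_def_of_ne_zero hw,
    log_ofReal_mul hr hw, ofReal_log hr.le, ← exp_add, add_mul]

theorem arg_mul_exp_mul_I {w : ℂ} (hw : w ≠ 0) {ψ : ℝ} (h : arg w + ψ ∈ Ioc (-Real.pi) Real.pi) :
    arg (w * cexp (ψ * I)) = arg w + ψ := by
  have hprod : w * cexp (ψ * I) = (‖w‖ : ℝ) * cexp ((arg w + ψ : ℝ) * I) := by
    rw [ofReal_add, add_mul, exp_add, ← mul_assoc, norm_mul_exp_arg_mul_I]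
  rw [hprod, arg_real_mul _ (norm_pos_iff.2 hw), arg_exp_mul_I, toIocMod_eq_self]
  rwa [show -Real.pi + 2 * Real.pi = Real.pi by ring]

theorem meromorphicAt_of_tendsto_sub_mul {f : ℂ → ℂ} {c b : ℂ}
    (hf : ∀ᶠ z in 𝓝[≠] c, DifferentiableAt ℂ f z)
    (hb : Tendsto (fun z => (z - c) * f z) (𝓝[≠] c) (𝓝 b)) : MeromorphicAt f c := by
  refine ⟨2, analyticAt_of_differentiable_on_punctured_nhds_of_continuousAt ?_ ?_⟩
  · filter_upwards [hf] with z hz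
    fun_prop
  · have hsub : Tendsto (fun z => z - c) (𝓝[≠] c) (𝓝 0) := by
      have : Continuous fun z : ℂ => z - c := by fun_prop
      simpa using (this.tendsto c).mono_left nhdsWithin_le_nhds
    refine continuousWithinAt_compl_self.1 ?_
    simpa [ContinuousWithinAt, sq, mul_assoc] using hsub.mul hb

theorem integrable_exp_neg_mul_abs {c : ℝ} (hc : 0 < c) :
    Integrable fun t : ℝ => Real.exp (-c * |t|) := by
  rw [← integrableOn_univ, ← Iic_union_Ioi (a := (0 : ℝ)), integrableOn_union]
  constructor
  · refine (integrableOn_exp_mul_Iic hc 0).congr_fun (fun t ht => ?_) measurableSet_Iic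
    rw [abs_of_nonpos ht, neg_mul_neg]
  · refine (exp_neg_integrableOn_Ioi 0 hc).congr_fun (fun t ht => ?_) measurableSet_Ioi
    rw [abs_of_pos ht]

theorem hasSum_pnat_iff_of_apply_zero {G : Type*} [AddCommGroup G] [TopologicalSpace G]
    [IsTopologicalAddGroup G] {f : ℕ → G} (hf : f 0 = 0) {b : G} :
    HasSum (fun n : ℕ+ => f n) b ↔ HasSum f b := by
  rw [hasSum_pnat_iff, hf, add_zero]

section ExpZeta

variable (a : UnitAddCircle) {s w : ℂ}

theorem hasSum_pnat_expZeta (hs : 1 < s.re) :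
    HasSum (fun n : ℕ+ => (((n : ℕ) • a).toCircle : ℂ) / (n : ℂ) ^ s) (expZeta a s) := by
  induction a using QuotientAddGroup.induction_on with | H a => ?_
  have hs0 : s ≠ 0 := by
    rintro rfl
    norm_num at hs
  have h := hasSum_expZeta_of_one_lt_re a hs
  refine ((hasSum_pnat_iff_of_apply_zero (by simp [hs0])).2 h).congr_fun fun n => ?_
  rw [AddCircle.toCircle_nsmul, AddCircle.toCircle_apply_mk, Circle.coe_pow, Circle.coe_exp,
    ← exp_nat_mul]
  push_cast
  ring_nf

theorem tendsto_sub_one_mul_expZeta :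
    Tendsto (fun s : ℂ => (s - 1) * expZeta a s) (𝓝[≠] 1) (𝓝 (expKernelResidue a)) := by
  by_cases ha : a = 0
  · simpa [ha, expKernelResidue, expZeta_zero] using riemannZeta_residue_one
  · have h : Continuous fun s : ℂ => (s - 1) * expZeta a s :=
      (continuous_id.sub continuous_const).mul (differentiable_expZeta_of_ne_zero ha).continuous
    simpa [ha, expKernelResidue] using (h.tendsto 1).mono_left nhdsWithin_le_nhds

theorem meromorphicAt_expZeta (s : ℂ) : MeromorphicAt (expZeta a) s := by
  have hd : ∀ z : ℂ, z ≠ 1 → DifferentiableAt ℂ (expZeta a) z := fun z hz =>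
    differentiableAt_expZeta a z (Or.inl hz)
  rcases eq_or_ne s 1 with rfl | hs
  · exact meromorphicAt_of_tendsto_sub_mul (eventually_mem_nhdsWithin.mono hd)
      (tendsto_sub_one_mul_expZeta a)
  · have hdiff : DifferentiableOn ℂ (expZeta a) {1}ᶜ := fun z hz =>
      (hd z hz).differentiableWithinAt
    exact (hdiff.analyticAt (isOpen_ne.mem_nhds hs)).meromorphicAt

/-- The Mellin transform of `t ↦ expKernel a (t * w)`, continued meromorphically to `ℂ`. -/
noncomputable def expKernelMellin (a : UnitAddCircle) (w s : ℂ) : ℂ :=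
  Gamma s * w ^ (-s) * expZeta a s

theorem mellin_expKernel (hw : 0 < w.re) (hs : 1 < s.re) :
    mellin (fun t : ℝ => expKernel a (t * w)) s = expKernelMellin a w s := by
  have hw0 := ne_zero_of_re_pos hw
  have hs0 : 0 < s.re := by linarith
  have hre : ∀ n : ℕ+, ((n : ℂ) * w).re = n * w.re := fun n => by simp
  have hnw : ∀ n : ℕ+, 0 < ((n : ℂ) * w).re := fun n => by
    rw [hre]
    positivity
  have hterm : ∀ n : ℕ+, HasMellin
      (fun t : ℝ => (((n : ℕ) • a).toCircle : ℂ) • cexp (-(n * w * t))) s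
      (Gamma s * w ^ (-s) * ((((n : ℕ) • a).toCircle : ℂ) / (n : ℂ) ^ s)) := fun n => by
    have h := hasMellin_cexp_neg_mul hs0 (hnw n)
    refine ⟨h.1.const_smul _, ?_⟩
    have hn := ofReal_mul_cpow (r := n) (by positivity) hw0 (-s)
    rw [ofReal_natCast] at hn
    rw [mellin_const_smul, h.2, hn, cpow_neg (n : ℂ), smul_eq_mul]
    ring
  have hnorm : ∀ n : ℕ+, ∫ t : ℝ in Ioi 0,
      ‖(t : ℂ) ^ (s - 1) • (((n : ℕ) • a).toCircle : ℂ) • cexp (-(n * w * t))‖ =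
      (1 / w.re) ^ s.re * Real.Gamma s.re * (1 / (n : ℝ) ^ s.re) := fun n => by
    have h := integral_norm_cpow_smul_cexp_neg_mul hs0 (hnw n)
    simp only [norm_smul, Circle.norm_coe, one_mul] at h ⊢
    rw [h, hre, ← one_div_mul_one_div, Real.mul_rpow (by positivity) (by positivity),
      Real.div_rpow zero_le_one (Nat.cast_nonneg _), Real.one_rpow]
    ring
  have hsum : Summable fun n : ℕ+ => (1 / w.re) ^ s.re * Real.Gamma s.re * (1 / (n : ℝ) ^ s.re) :=
    ((Real.summable_one_div_nat_rpow.2 hs).comp_injective PNat.coe_injective).mul_left _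
  have hmellin := hasSum_mellin_of_summable_integral_norm (fun n => (hterm n).1)
    (hsum.congr fun n => (hnorm n).symm) (F := fun t => expKernel a (t * w))
    fun t (ht : 0 < t) => by
      have htw : 0 < ((t : ℂ) * w).re := by
        rw [re_ofReal_mul]
        positivity
      simpa only [smul_eq_mul, mul_comm (t : ℂ) w, mul_assoc] using hasSum_expKernel a htw
  simp only [(hterm _).2] at hmellin
  exact hmellin.unique ((hasSum_pnat_expZeta a hs).mul_left _)

theorem meromorphicAt_expKernelMellin (hw : w ≠ 0) (s : ℂ) :
    MeromorphicAt (expKernelMellin a w) s := by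
  have hpow : AnalyticAt ℂ (fun s => w ^ (-s)) s := by
    have : Differentiable ℂ fun s : ℂ => w ^ (-s) := fun s =>
      differentiableAt_id.neg.const_cpow (Or.inl hw)
    exact this.analyticAt s
  exact ((MeromorphicOn.Gamma (s := univ) s (mem_univ s)).mul hpow.meromorphicAt).mul
    (meromorphicAt_expZeta a s)

theorem continuousAt_Gamma_mul_cpow_neg (hw : w ≠ 0) (hs : -1 < s.re) (hs0 : s.re < 0) :
    ContinuousAt (fun s => Gamma s * w ^ (-s)) s := by
  have hΓ : DifferentiableAt ℂ Gamma s := differentiableAt_Gamma s fun m hm => by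
    rw [hm, neg_re, natCast_re] at hs hs0
    have h0 : 0 < m := by exact_mod_cast neg_lt_zero.1 hs0
    have h1 : m < 1 := by exact_mod_cast neg_lt_neg_iff.1 hs
    omega
  exact (hΓ.mul (differentiableAt_id.neg.const_cpow (Or.inl hw))).continuousAt

theorem continuousAt_expKernelMellin (hw : w ≠ 0) (hs : -1 < s.re) (hs0 : s.re < 0) :
    ContinuousAt (expKernelMellin a w) s := by
  have hs1 : s ≠ 1 := by
    rintro rfl
    norm_num at hs0
  exact (continuousAt_Gamma_mul_cpow_neg hw hs hs0).mul
    (differentiableAt_expZeta a s (Or.inl hs1)).continuousAt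

theorem hasMellin_expKernel_sub_polar (hw : 0 < w.re) (hs : -1 < s.re) (hs0 : s.re < 0) :
    HasMellin (fun t : ℝ => expKernel a (t * w) - (expKernelResidue a / w / t + expKernelConst a))
      s (expKernelMellin a w s) :=
  have hw0 := ne_zero_of_re_pos hw
  (hasPolarExpansion_expKernel a hw).hasMellin_sub_polar
    (fun s _ => meromorphicAt_expKernelMellin a hw0 s) (fun _ hs => (mellin_expKernel a hw hs).symm)
    hs hs0 (continuousAt_expKernelMellin a hw0 hs hs0)

theorem expZeta_apply_zero : expZeta a 0 = expKernelConst a := by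
  have hΓ : Tendsto (fun s => s * expKernelMellin a 1 s) (𝓝[≠] 0) (𝓝 (expZeta a 0)) := by
    have hcont : Tendsto (expZeta a) (𝓝[≠] 0) (𝓝 (expZeta a 0)) :=
      (differentiableAt_expZeta a 0 (by simp)).continuousAt.continuousWithinAt
    simpa [expKernelMellin, mul_assoc] using tendsto_self_mul_Gamma_nhds_zero.mul hcont
  exact tendsto_nhds_unique hΓ <|
    (hasPolarExpansion_expKernel a (w := 1) (by simp)).tendsto_mul_continuation
      (fun s _ => meromorphicAt_expKernelMellin a one_ne_zero s)
      fun _ hs => (mellin_expKernel a (by simp) hs).symm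

section VerticalLine

variable {σ : ℝ}

theorem exists_norm_expKernelMellin_le (hσ : σ ∈ Ioo (-1) 0) (hw : 0 < w.re) :
    ∃ C, ∀ s : ℂ, s.re = σ → ‖expKernelMellin a w s‖ ≤ C := by
  refine ⟨∫ t : ℝ in Ioi 0, t ^ (σ - 1) *
    ‖expKernel a (t * w) - (expKernelResidue a / w / t + expKernelConst a)‖, fun s hs => ?_⟩
  rw [← (hasMellin_expKernel_sub_polar a hw (hs ▸ hσ.1) (hs ▸ hσ.2)).2]
  exact hs ▸ norm_mellin_le s

theorem norm_expKernelMellin_mul_exp_mul_I (hw : w ≠ 0) {ψ : ℝ}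
    (h : arg w + ψ ∈ Ioc (-Real.pi) Real.pi) (s : ℂ) :
    ‖expKernelMellin a (w * cexp (ψ * I)) s‖ = ‖expKernelMellin a w s‖ * Real.exp (ψ * s.im) := by
  have hne : w * cexp (ψ * I) ≠ 0 := mul_ne_zero hw (exp_ne_zero _)
  simp only [expKernelMellin, norm_mul (_ * _ : ℂ), norm_mul (Gamma s)]
  rw [norm_cpow_of_ne_zero hne, norm_cpow_of_ne_zero hw, arg_mul_exp_mul_I hw h, norm_mul,
    norm_exp_ofReal_mul_I, mul_one, neg_im, mul_neg, mul_neg, Real.exp_neg, Real.exp_neg,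
    add_mul, Real.exp_add]
  field_simp

/- Turning `w` by an angle `±δ` changes the norm by a factor `exp (±δ * im s)` but keeps the
transform bounded, so the bound on the vertical line improves to exponential decay. -/
theorem exists_norm_expKernelMellin_le_exp (hσ : σ ∈ Ioo (-1) 0) (hw : 0 < w.re) :
    ∃ C, ∃ c > 0, ∀ s : ℂ, s.re = σ → ‖expKernelMellin a w s‖ ≤ C * Real.exp (-c * |s.im|) := by
  have hw0 := ne_zero_of_re_pos hw
  have harg : |arg w| < Real.pi / 2 := abs_arg_lt_pi_div_two_iff.2 (Or.inl hw)
  obtain ⟨δ, hδ0, hδ⟩ := exists_between (sub_pos.2 harg)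
  have hrot : ∀ ψ : ℝ, |ψ| = δ →
      ∃ C, ∀ s : ℂ, s.re = σ → ‖expKernelMellin a w s‖ * Real.exp (ψ * s.im) ≤ C := by
    intro ψ hψ
    have hlt : |arg w + ψ| < Real.pi / 2 := (abs_add_le _ _).trans_lt (by linarith)
    have hmem : arg w + ψ ∈ Ioc (-Real.pi) Real.pi :=
      ⟨by linarith [(abs_lt.1 hlt).1, Real.pi_pos], by linarith [(abs_lt.1 hlt).2, Real.pi_pos]⟩
    have hre : 0 < (w * cexp (ψ * I)).re := by
      refine (abs_arg_lt_pi_div_two_iff.1 ?_).resolve_right (mul_ne_zero hw0 (exp_ne_zero _))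
      rwa [arg_mul_exp_mul_I hw0 hmem]
    obtain ⟨C, hC⟩ := exists_norm_expKernelMellin_le a hσ hre
    exact ⟨C, fun s hs => norm_expKernelMellin_mul_exp_mul_I a hw0 hmem s ▸ hC s hs⟩
  obtain ⟨C₁, h₁⟩ := hrot δ (abs_of_pos hδ0)
  obtain ⟨C₂, h₂⟩ := hrot (-δ) (by rw [abs_neg, abs_of_pos hδ0])
  refine ⟨max C₁ C₂, δ, hδ0, fun s hs => ?_⟩
  rw [neg_mul, Real.exp_neg, ← div_eq_mul_inv, le_div_iff₀ (Real.exp_pos _)]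
  rcases abs_cases s.im with ⟨h, _⟩ | ⟨h, _⟩
  · rw [h]
    exact (h₁ s hs).trans (le_max_left _ _)
  · rw [h, mul_neg, ← neg_mul]
    exact (h₂ s hs).trans (le_max_right _ _)

theorem integrable_expKernelMellin (hσ : σ ∈ Ioo (-1) 0) (hw : 0 < w.re) :
    Integrable fun t : ℝ => expKernelMellin a w (σ + t * I) := by
  obtain ⟨C, c, hc, hC⟩ := exists_norm_expKernelMellin_le_exp a hσ hw
  refine ((integrable_exp_neg_mul_abs hc).const_mul C).mono'
    (Continuous.aestronglyMeasurable ?_) (Eventually.of_forall fun t => ?_)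
  · refine continuous_iff_continuousAt.2 fun t => ?_
    exact ContinuousAt.comp (f := fun t : ℝ => (σ : ℂ) + t * I)
      (continuousAt_expKernelMellin a (ne_zero_of_re_pos hw) (by simpa using hσ.1)
        (by simpa using hσ.2)) (by fun_prop)
  · simpa using hC (σ + t * I) (by simp)

theorem expKernel_eq_integral (hσ : σ ∈ Ioo (-1) 0) (hw : 0 < w.re) :
    expKernel a w = expKernelResidue a / w + expKernelConst a +
      1 / (2 * Real.pi) * ∫ t : ℝ, expKernelMellin a w (σ + t * I) := by
  set g : ℝ → ℂ := fun t => expKernel a (t * w) - (expKernelResidue a / w / t + expKernelConst a)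
    with hg
  have hmellin : ∀ t : ℝ, HasMellin g (σ + t * I) (expKernelMellin a w (σ + t * I)) := fun t =>
    hasMellin_expKernel_sub_polar a hw (by simpa using hσ.1) (by simpa using hσ.2)
  have hvert : VerticalIntegrable (mellin g) σ := by
    simpa only [VerticalIntegrable, (hmellin _).2] using integrable_expKernelMellin a hσ hw
  have hcont : ContinuousAt g 1 := by
    refine ((hasPolarExpansion_expKernel a hw).continuousOn.continuousAt (Ioi_mem_nhds one_pos)).sub
      (ContinuousAt.add ?_ continuousAt_const)
    exact continuousAt_const.div (by fun_prop) (by simp)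
  have hinv := mellinInv_mellin_eq σ g one_pos (by simpa using (hmellin 0).1) hvert hcont
  simp only [mellinInv, (hmellin _).2, ofReal_one, one_cpow, one_smul] at hinv
  simp only [hg, ofReal_one, one_mul, div_one] at hinv
  rw [← sub_eq_iff_eq_add', ← hinv, real_smul]
  push_cast
  rfl

end VerticalLine

end ExpZeta

/-! ### The double series and its continuation -/

section FinAddOrder

variable {M : Type*} [AddLeftCancelMonoid M] {a : M}

theorem bddAbove_range_nsmul (ha : IsOfFinAddOrder a) (f : M → ℝ) :
    BddAbove (range fun n : ℕ => f (n • a)) := by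
  refine (((finite_multiples.2 ha).image f).subset ?_).bddAbove
  rintro _ ⟨n, rfl⟩
  exact mem_image_of_mem f ⟨n, rfl⟩

theorem eventually_forall_nsmul {α : Type*} {𝓕 : Filter α} (ha : IsOfFinAddOrder a)
    {p : M → α → Prop} (hp : ∀ b, ∀ᶠ s in 𝓕, p b s) : ∀ᶠ s in 𝓕, ∀ n : ℕ, p (n • a) s :=
  ((eventually_all_finite (finite_multiples.2 ha)).2 fun b _ => hp b).mono
    fun _ hs n => hs (n • a) ⟨n, rfl⟩

theorem exists_eventually_norm_nsmul_le {α E : Type*} [NormedAddCommGroup E] {𝓕 : Filter α}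
    (ha : IsOfFinAddOrder a) {F : M → α → E} {f : M → E}
    (hF : ∀ b, Tendsto (F b) 𝓕 (𝓝 (f b))) : ∃ C, ∀ᶠ s in 𝓕, ∀ n : ℕ, ‖F (n • a) s‖ ≤ C := by
  obtain ⟨C, hC⟩ := bddAbove_range_nsmul ha fun b => ‖f b‖ + 1
  have hle : ∀ b, ∀ᶠ s in 𝓕, ‖F b s‖ ≤ ‖f b‖ + 1 := fun b =>
    (hF b).norm.eventually_le_const (lt_add_one _)
  exact ⟨C, (eventually_forall_nsmul ha hle).mono fun s hs n => (hs n).trans (hC ⟨n, rfl⟩)⟩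

end FinAddOrder

/-- The term `x ^ l / l ^ (s + 1)` of the polylogarithm of order `s + 1`, in the form
`x ^ l / l * l ^ (-s)`. -/
noncomputable def polylogTerm (x s : ℂ) (l : ℕ+) : ℂ :=
  x ^ (l : ℕ) / (l : ℂ) * (l : ℂ) ^ (-s)

section PolylogTerm

variable {x : ℂ}

theorem norm_polylogTerm (x s : ℂ) (l : ℕ+) :
    ‖polylogTerm x s l‖ = ‖x‖ ^ (l : ℕ) / l * (l : ℝ) ^ (-s.re) := by
  rw [polylogTerm, norm_mul, norm_div, norm_pow, norm_natCast,
    norm_natCast_cpow_of_pos l.pos, neg_re]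

theorem norm_polylogTerm_le (x : ℂ) {s : ℂ} {N : ℕ} (hs : -N ≤ s.re) (l : ℕ+) :
    ‖polylogTerm x s l‖ ≤ (l : ℝ) ^ N * ‖x‖ ^ (l : ℕ) := by
  have hl : (1 : ℝ) ≤ l := by exact_mod_cast l.pos
  rw [norm_polylogTerm, mul_comm]
  gcongr
  · rw [← Real.rpow_natCast]
    exact Real.rpow_le_rpow_of_exponent_le hl (by linarith)
  · exact div_le_self (by positivity) hl

theorem polylogTerm_one (x : ℂ) (l : ℕ+) : polylogTerm x 1 l = x ^ (l : ℕ) / (l : ℂ) ^ 2 := by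
  rw [polylogTerm, cpow_neg_one, ← div_eq_mul_inv, div_div, sq]

theorem polylogTerm_zero (x : ℂ) (l : ℕ+) : polylogTerm x 0 l = x ^ (l : ℕ) / l := by
  rw [polylogTerm, neg_zero, cpow_zero, mul_one]

theorem differentiable_polylogTerm (x : ℂ) (l : ℕ+) :
    Differentiable ℂ fun s => polylogTerm x s l := fun _ =>
  (differentiableAt_id.neg.const_cpow (Or.inl (by simp))).const_mul _

theorem summable_pnat_pow_mul_pow (hx : ‖x‖ < 1) (N : ℕ) :
    Summable fun l : ℕ+ => (l : ℝ) ^ N * ‖x‖ ^ (l : ℕ) :=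
  (summable_pow_mul_geometric_of_norm_lt_one N (r := ‖x‖) (by simpa using hx)).comp_injective
    PNat.coe_injective

theorem summable_norm_polylogTerm (hx : ‖x‖ < 1) (s : ℂ) :
    Summable fun l => ‖polylogTerm x s l‖ := by
  obtain ⟨N, hN⟩ := exists_nat_ge (-s.re)
  exact (summable_pnat_pow_mul_pow hx N).of_nonneg_of_le (fun _ => norm_nonneg _)
    (norm_polylogTerm_le x (by linarith))

theorem summable_polylogTerm_mul_nsmul {M : Type*} [AddLeftCancelMonoid M] {a : M} (hx : ‖x‖ < 1)
    (ha : IsOfFinAddOrder a) (s : ℂ) (f : M → ℂ) :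
    Summable fun l : ℕ+ => polylogTerm x s l * f ((l : ℕ) • a) := by
  obtain ⟨C, hC⟩ := bddAbove_range_nsmul ha fun b => ‖f b‖
  refine ((summable_norm_polylogTerm hx s).mul_right C).of_norm_bounded fun l => ?_
  rw [norm_mul]
  gcongr
  exact hC ⟨l, rfl⟩

end PolylogTerm

/-- The analytic continuation of the double series `∑ (x ^ l e^{2πilma} / l) (l m)^{-s}`, obtained
by summing over `m` first. -/
noncomputable def qFun (x : ℂ) (a : UnitAddCircle) (s : ℂ) : ℂ :=
  ∑' l : ℕ+, polylogTerm x s l * expZeta ((l : ℕ) • a) s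

section QFun

variable {x : ℂ} {a : UnitAddCircle}

theorem hasSum_qFun (hx : ‖x‖ < 1) (ha : IsOfFinAddOrder a) (s : ℂ) :
    HasSum (fun l : ℕ+ => polylogTerm x s l * expZeta ((l : ℕ) • a) s) (qFun x a s) :=
  (summable_polylogTerm_mul_nsmul hx ha s fun b => expZeta b s).hasSum

theorem differentiableOn_qFun (hx : ‖x‖ < 1) (ha : IsOfFinAddOrder a) :
    DifferentiableOn ℂ (qFun x a) {1}ᶜ := by
  intro s (hs : s ≠ 1)
  obtain ⟨N, hN⟩ := exists_nat_gt (-s.re)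
  obtain ⟨C, hC⟩ := exists_eventually_norm_nsmul_le ha fun b =>
    (differentiableAt_expZeta b s (Or.inl hs)).continuousAt
  have hre : ∀ᶠ z : ℂ in 𝓝 s, -N < z.re :=
    continuous_re.continuousAt.eventually_const_lt (by linarith)
  obtain ⟨U, hU, hopen, hsU⟩ := eventually_nhds_iff.1 (hC.and (hre.and (eventually_ne_nhds hs)))
  refine (differentiableOn_tsum_of_summable_norm ((summable_pnat_pow_mul_pow hx N).mul_right C)
    (fun l z hz => ?_) hopen fun l z hz => ?_).differentiableAt
    (hopen.mem_nhds hsU) |>.differentiableWithinAt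
  · exact ((differentiable_polylogTerm x l z).mul
      (differentiableAt_expZeta _ z (Or.inl (hU z hz).2.2))).differentiableWithinAt
  · rw [norm_mul]
    exact mul_le_mul (norm_polylogTerm_le x (hU z hz).2.1.le l) ((hU z hz).1 l) (norm_nonneg _)
      (by positivity)

theorem tendsto_sub_one_mul_qFun (hx : ‖x‖ < 1) (ha : IsOfFinAddOrder a) :
    Tendsto (fun s : ℂ => (s - 1) * qFun x a s) (𝓝[≠] 1)
      (𝓝 (∑' l : ℕ+, polylogTerm x 1 l * expKernelResidue ((l : ℕ) • a))) := by
  obtain ⟨C, hC⟩ := exists_eventually_norm_nsmul_le ha tendsto_sub_one_mul_expZeta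
  have hre : ∀ᶠ s : ℂ in 𝓝[≠] 1, -(0 : ℕ) ≤ s.re :=
    (continuous_re.continuousAt.eventually_const_le (by norm_num)).filter_mono nhdsWithin_le_nhds
  simp only [qFun, ← tsum_mul_left, mul_left_comm _ (polylogTerm x _ _)]
  refine tendsto_tsum_of_dominated_convergence ((summable_pnat_pow_mul_pow hx 0).mul_right C)
    (fun l => ?_) ?_
  · have hterm : Tendsto (fun s => polylogTerm x s l) (𝓝[≠] 1) (𝓝 (polylogTerm x 1 l)) :=
      (differentiable_polylogTerm x l 1).continuousAt.continuousWithinAt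
    exact hterm.mul (tendsto_sub_one_mul_expZeta _)
  · filter_upwards [hC, hre] with s hs hs0 l
    rw [norm_mul]
    exact mul_le_mul (norm_polylogTerm_le x hs0 l) (hs l) (norm_nonneg _) (by positivity)

theorem qFun_apply_zero (x : ℂ) (a : UnitAddCircle) :
    qFun x a 0 = ∑' l : ℕ+, polylogTerm x 0 l * expKernelConst ((l : ℕ) • a) := by
  simp only [qFun, expZeta_apply_zero]

theorem polylogTerm_mul_expKernelMellin (x s : ℂ) (b : UnitAddCircle) {w : ℂ} (hw : w ≠ 0)
    (l : ℕ+) :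
    polylogTerm x s l * expKernelMellin b w s =
      x ^ (l : ℕ) / l * expKernelMellin b ((l : ℕ) * w) s := by
  have hl := ofReal_mul_cpow (r := l) (by positivity) hw (-s)
  rw [ofReal_natCast] at hl
  rw [polylogTerm, expKernelMellin, expKernelMellin, hl]
  ring

section VerticalLine

variable {σ : ℝ}

/- On a vertical line `‖polylogTerm x s l‖` is constant and only finitely many functions
`expKernelMellin (l • a) w` occur, so their sum dominates every term. -/
theorem exists_integrable_polylogTerm_mul_le (ha : IsOfFinAddOrder a) (hσ : σ ∈ Ioo (-1) 0)
    {w : ℂ} (hw : 0 < w.re) (x : ℂ) : ∃ g : ℝ → ℝ, Integrable g ∧ ∀ (l : ℕ+) (t : ℝ),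
      ‖polylogTerm x (σ + t * I) l * expKernelMellin ((l : ℕ) • a) w (σ + t * I)‖ ≤
        ‖polylogTerm x σ l‖ * g t := by
  have hfin := finite_multiples.2 ha
  refine ⟨fun t => ∑ b ∈ hfin.toFinset, ‖expKernelMellin b w (σ + t * I)‖,
    integrable_finsetSum _ fun b _ => (integrable_expKernelMellin b hσ hw).norm, fun l t => ?_⟩
  have hre : ((σ : ℂ) + t * I).re = (σ : ℂ).re := by simp
  rw [norm_mul, norm_polylogTerm, hre, ← norm_polylogTerm]
  gcongr
  exact Finset.single_le_sum (f := fun b => ‖expKernelMellin b w (σ + t * I)‖)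
    (fun _ _ => norm_nonneg _) (hfin.mem_toFinset.2 ⟨l, rfl⟩)

theorem two_pi_mul_re_pos {z : ℂ} (hz : 0 < z.re) : 0 < (2 * Real.pi * z).re := by
  have h : (2 * Real.pi * z).re = 2 * Real.pi * z.re := by simp
  rw [h]
  positivity

theorem hasSum_jIntegrand_qFun (hx : ‖x‖ < 1) (ha : IsOfFinAddOrder a) (z s : ℂ) :
    HasSum (fun l : ℕ+ => polylogTerm x s l * expKernelMellin ((l : ℕ) • a) (2 * Real.pi * z) s)
      (jIntegrand (qFun x a) z s) := by
  rw [jIntegrand, mul_assoc (qFun x a s)]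
  refine ((hasSum_qFun hx ha s).mul_right _).congr_fun fun l => ?_
  rw [expKernelMellin]
  ring

theorem continuousAt_jIntegrand_qFun (hx : ‖x‖ < 1) (ha : IsOfFinAddOrder a) {z : ℂ} (hz : z ≠ 0)
    {s : ℂ} (hs : s.re ∈ Ioo (-1) 0) : ContinuousAt (jIntegrand (qFun x a) z) s := by
  have hs1 : s ≠ 1 := by
    rintro rfl
    norm_num at hs
  have hw : 2 * Real.pi * z ≠ 0 := mul_ne_zero (by simp [Real.pi_ne_zero]) hz
  unfold jIntegrand
  simp only [mul_assoc (qFun x a _)]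
  exact ((differentiableOn_qFun hx ha).differentiableAt
    (isOpen_ne.mem_nhds hs1)).continuousAt.mul (continuousAt_Gamma_mul_cpow_neg hw hs.1 hs.2)

theorem integrable_jIntegrand_qFun (hx : ‖x‖ < 1) (ha : IsOfFinAddOrder a)
    (hσ : σ ∈ Ioo (-1) 0) {z : ℂ} (hz : 0 < z.re) :
    Integrable fun t : ℝ => jIntegrand (qFun x a) z (σ + t * I) := by
  obtain ⟨g, hg, hle⟩ :=
    exists_integrable_polylogTerm_mul_le ha hσ (two_pi_mul_re_pos hz) x
  refine (hg.const_mul (∑' l, ‖polylogTerm x σ l‖)).mono'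
    (Continuous.aestronglyMeasurable ?_) (Eventually.of_forall fun t => ?_)
  · refine continuous_iff_continuousAt.2 fun t => ?_
    exact ContinuousAt.comp (f := fun t : ℝ => (σ : ℂ) + t * I)
      (continuousAt_jIntegrand_qFun hx ha (ne_zero_of_re_pos hz) (by simpa using hσ)) (by fun_prop)
  · rw [← (hasSum_jIntegrand_qFun hx ha z _).tsum_eq]
    exact tsum_of_norm_bounded ((summable_norm_polylogTerm hx σ).hasSum.mul_right _)
      fun l => hle l t

theorem hasSum_integral_expKernelMellin (hx : ‖x‖ < 1) (ha : IsOfFinAddOrder a)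
    (hσ : σ ∈ Ioo (-1) 0) {z : ℂ} (hz : 0 < z.re) :
    HasSum (fun l : ℕ+ => x ^ (l : ℕ) / l *
        ∫ t : ℝ, expKernelMellin ((l : ℕ) • a) ((l : ℕ) * (2 * Real.pi * z)) (σ + t * I))
      (∫ t : ℝ, jIntegrand (qFun x a) z (σ + t * I)) := by
  have hw := two_pi_mul_re_pos hz
  obtain ⟨g, hg, hle⟩ := exists_integrable_polylogTerm_mul_le ha hσ hw x
  have hsum := summable_norm_polylogTerm hx σ
  simp only [← integral_const_mul, ← polylogTerm_mul_expKernelMellin x _ _ (ne_zero_of_re_pos hw)]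
  refine hasSum_integral_of_dominated_convergence (fun l t => ‖polylogTerm x σ l‖ * g t)
    (fun l => Continuous.aestronglyMeasurable ?_) (fun l => Eventually.of_forall (hle l))
    (Eventually.of_forall fun t => hsum.mul_right (g t)) ?_
    (Eventually.of_forall fun t => hasSum_jIntegrand_qFun hx ha z _)
  · refine continuous_iff_continuousAt.2 fun t => ?_
    exact ContinuousAt.comp (f := fun t : ℝ => (σ : ℂ) + t * I)
      ((differentiable_polylogTerm x l _).continuousAt.mul (continuousAt_expKernelMellin _
        (ne_zero_of_re_pos hw) (by simpa using hσ.1) (by simpa using hσ.2))) (by fun_prop)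
  · simpa only [tsum_mul_right] using hg.const_mul _

theorem hasSum_pow_div_mul_expKernel (hx : ‖x‖ < 1) (ha : IsOfFinAddOrder a)
    (hσ : σ ∈ Ioo (-1) 0) {z : ℂ} (hz : 0 < z.re) :
    HasSum (fun l : ℕ+ => x ^ (l : ℕ) / l * expKernel ((l : ℕ) • a) ((l : ℕ) * (2 * Real.pi * z)))
      (∑' l : ℕ+, polylogTerm x 0 l * expKernelConst ((l : ℕ) • a) +
        (∑' l : ℕ+, polylogTerm x 1 l * expKernelResidue ((l : ℕ) • a)) / (2 * Real.pi * z) +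
        1 / (2 * Real.pi) * ∫ t : ℝ, jIntegrand (qFun x a) z (σ + t * I)) := by
  have hpos : ∀ l : ℕ+, 0 < ((l : ℂ) * (2 * Real.pi * z)).re := fun l => by
    rw [← ofReal_natCast, re_ofReal_mul]
    exact mul_pos (by positivity) (two_pi_mul_re_pos hz)
  have hconst := (summable_polylogTerm_mul_nsmul hx ha 0 expKernelConst).hasSum
  have hres := (summable_polylogTerm_mul_nsmul hx ha 1 expKernelResidue).hasSum
  have hint := hasSum_integral_expKernelMellin hx ha hσ hz
  refine ((hconst.add (hres.div_const _)).add (hint.mul_left _)).congr_fun fun l => ?_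
  rw [expKernel_eq_integral _ hσ (hpos l), polylogTerm_one, polylogTerm_zero, mul_add, mul_add]
  have hz0 := ne_zero_of_re_pos hz
  generalize (∫ t : ℝ, _ : ℂ) = J
  field_simp
  ring

end VerticalLine

end QFun

/-! ### Rational phases -/

/-- The class of `h / k` in `ℝ / ℤ`. -/
noncomputable def cuspClass (h : ℤ) (k : ℕ) : UnitAddCircle := ((h / k : ℝ) : UnitAddCircle)

theorem toCircle_nsmul_cuspClass (h : ℤ) (k n : ℕ) :
    ((n • cuspClass h k).toCircle : ℂ) = cexp (2 * Real.pi * I * n * h / k) := by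
  rw [AddCircle.toCircle_nsmul, cuspClass, AddCircle.toCircle_apply_mk, Circle.coe_pow,
    Circle.coe_exp, ← exp_nat_mul]
  congr 1
  push_cast
  ring

theorem expKernel_nsmul_cuspClass_zero (h : ℤ) (k n : ℕ) :
    expKernel (n • cuspClass h k) 0 = 1 / (cexp (-(2 * Real.pi * I * n * h / k)) - 1) := by
  rw [expKernel, AddCircle.toCircle_neg, Circle.coe_inv, toCircle_nsmul_cuspClass, exp_zero,
    mul_one, exp_neg]

section Coprime

variable {h : ℤ} {k : ℕ} (hk : 0 < k) (hcop : IsCoprime h (k : ℤ))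

include hk hcop

theorem addOrderOf_cuspClass : addOrderOf (cuspClass h k) = k := by
  have hgcd : h.natAbs.gcd k = 1 := Int.isCoprime_iff_gcd_eq_one.1 hcop
  rw [cuspClass, ← mul_one (h / k : ℝ)]
  exact AddCircle.addOrderOf_div_of_gcd_eq_one' hk hgcd

theorem isOfFinAddOrder_cuspClass : IsOfFinAddOrder (cuspClass h k) :=
  addOrderOf_pos_iff.1 ((addOrderOf_cuspClass hk hcop).symm ▸ hk)

theorem nsmul_cuspClass_eq_zero_iff (n : ℕ) : n • cuspClass h k = 0 ↔ k ∣ n := by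
  rw [← addOrderOf_dvd_iff_nsmul_eq_zero, addOrderOf_cuspClass hk hcop]

end Coprime

theorem qTerm_eq (x : ℂ) (h : ℤ) (k : ℕ) (s : ℂ) (m l : ℕ+) :
    qTerm x h k s (m, l) = polylogTerm x s l *
      ((((m : ℕ) • (l : ℕ) • cuspClass h k).toCircle : ℂ) / (m : ℂ) ^ s) := by
  rw [qTerm, polylogTerm, natCast_mul_natCast_cpow, cpow_neg (m : ℂ), smul_smul,
    toCircle_nsmul_cuspClass]
  push_cast
  rw [show 2 * Real.pi * I * (m * l : ℂ) * h / k = 2 * Real.pi * I * l * m * h / k by ring]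
  ring

theorem hasSum_of_hasSum_columns {β γ E : Type*} [NormedAddCommGroup E] [CompleteSpace E]
    {F : β × γ → E} {u : β → ℝ} {v : γ → ℝ} (hu : Summable u) (hv : Summable v)
    (hF : ∀ m l, ‖F (m, l)‖ ≤ u m * v l) {g : γ → E} (hg : ∀ l, HasSum (fun m => F (m, l)) (g l))
    {b : E} (hb : HasSum g b) : HasSum F b := by
  have hsum : Summable F := by
    refine (hu.abs.mul_of_nonneg hv.abs (fun _ => abs_nonneg _)
      fun _ => abs_nonneg _).of_norm_bounded fun p => (hF p.1 p.2).trans ?_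
    rw [← abs_mul]
    exact le_abs_self _
  have hswap : HasSum (fun p : γ × β => F (p.2, p.1)) (∑' p, F p) :=
    (Equiv.prodComm γ β).hasSum_iff.2 hsum.hasSum
  rw [hb.unique (hswap.prod_fiberwise hg)]
  exact hsum.hasSum

theorem hasSum_qTerm {x : ℂ} (hx : ‖x‖ < 1) {h : ℤ} {k : ℕ} (hk : 0 < k)
    (hcop : IsCoprime h (k : ℤ)) {s : ℂ} (hs : 1 < s.re) :
    HasSum (qTerm x h k s) (qFun x (cuspClass h k) s) := by
  have hu : Summable fun m : ℕ+ => 1 / (m : ℝ) ^ s.re :=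
    (Real.summable_one_div_nat_rpow.2 hs).comp_injective PNat.coe_injective
  refine hasSum_of_hasSum_columns hu (summable_norm_polylogTerm hx s) (fun m l => ?_) (fun l => ?_)
    (hasSum_qFun hx (isOfFinAddOrder_cuspClass hk hcop) s)
  · rw [qTerm_eq, norm_mul, norm_div, Circle.norm_coe, norm_natCast_cpow_of_pos m.pos, mul_comm]
  · simp only [qTerm_eq]
    exact (hasSum_pnat_expZeta _ hs).mul_left _

theorem hasSum_pnat_of_multiples {G : Type*} [AddCommMonoid G] [TopologicalSpace G] {g : ℕ → G}
    {k : ℕ} (hk : 0 < k) {b : G} (hb : HasSum (fun n : ℕ+ => g (k * n)) b) :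
    HasSum (fun l : ℕ+ => if k ∣ (l : ℕ) then g l else 0) b := by
  have hinj : Function.Injective fun n : ℕ+ => k.toPNat hk * n := mul_right_injective _
  refine (hinj.hasSum_iff fun l hl => if_neg fun ⟨n, hn⟩ => hl ?_).1 (hb.congr_fun fun n => ?_)
  · exact if_pos (dvd_mul_right _ _)
  · exact ⟨⟨n, Nat.pos_of_ne_zero fun h0 => l.ne_zero (by rw [hn, h0, mul_zero])⟩,
      PNat.eq hn.symm⟩

theorem norm_pow_lt_one {x : ℂ} (hx : ‖x‖ < 1) {k : ℕ} (hk : 0 < k) : ‖x ^ k‖ < 1 := by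
  rw [norm_pow]
  exact pow_lt_one₀ (norm_nonneg _) hx hk.ne'

theorem hasSum_dilog {y : ℂ} (hy : ‖y‖ < 1) :
    HasSum (fun n : ℕ+ => y ^ (n : ℕ) / (n : ℂ) ^ 2) (dilog y) :=
  ((summable_norm_polylogTerm hy 1).of_norm.congr (polylogTerm_one y)).hasSum

theorem norm_dilog_sub_self_le {y : ℂ} (hy : ‖y‖ < 1) :
    ‖dilog y - y‖ ≤ ‖y‖ * (Real.pi ^ 2 / 6 - 1) := by
  have hnat : HasSum (fun n : ℕ => y ^ n / (n : ℂ) ^ 2) (dilog y) :=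
    (hasSum_pnat_iff_of_apply_zero (by simp)).1 (hasSum_dilog hy)
  have hdilog : HasSum (fun n : ℕ => y ^ (n + 2) / ((n + 2 : ℕ) : ℂ) ^ 2) (dilog y - y) := by
    simpa [Finset.sum_range_succ] using (hasSum_nat_add_iff' 2).2 hnat
  have hzeta : HasSum (fun n : ℕ => 1 / ((n + 2 : ℕ) : ℝ) ^ 2) (Real.pi ^ 2 / 6 - 1) := by
    simpa [Finset.sum_range_succ] using (hasSum_nat_add_iff' 2).2 hasSum_zeta_two
  rw [← hdilog.tsum_eq]
  refine tsum_of_norm_bounded (hzeta.mul_left ‖y‖) fun n => ?_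
  rw [norm_div, norm_pow, norm_pow, norm_natCast, div_eq_mul_one_div]
  gcongr
  exact pow_le_of_le_one (norm_nonneg _) hy.le (by omega)

theorem dilog_ne_zero {y : ℂ} (hy0 : y ≠ 0) (hy : ‖y‖ < 1) : dilog y ≠ 0 := by
  intro h0
  have hle := norm_dilog_sub_self_le hy
  rw [h0, zero_sub, norm_neg] at hle
  have hpi : Real.pi ^ 2 / 6 - 1 < 1 := by nlinarith [Real.pi_lt_d2, Real.pi_pos]
  exact absurd hle (not_le.2 (mul_lt_of_lt_one_right (norm_pos_iff.2 hy0) hpi))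

section CuspClass

variable {h : ℤ} {k : ℕ} (hk : 0 < k) (hcop : IsCoprime h (k : ℤ)) {x : ℂ} (hx : ‖x‖ < 1)

include hk hcop hx

theorem tsum_polylogTerm_mul_expKernelResidue :
    ∑' l : ℕ+, polylogTerm x 1 l * expKernelResidue ((l : ℕ) • cuspClass h k) =
      dilog (x ^ k) / (k : ℂ) ^ 2 := by
  have hdilog := (hasSum_dilog (norm_pow_lt_one hx hk)).div_const ((k : ℂ) ^ 2)
  have hmul : HasSum (fun l : ℕ+ => if k ∣ (l : ℕ) then x ^ (l : ℕ) / (l : ℂ) ^ 2 else 0)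
      (dilog (x ^ k) / (k : ℂ) ^ 2) := by
    refine hasSum_pnat_of_multiples (g := fun l => x ^ l / (l : ℂ) ^ 2) hk
      (hdilog.congr_fun fun n => ?_)
    rw [Nat.cast_mul, mul_pow, pow_mul, div_div, mul_comm ((k : ℂ) ^ 2)]
  refine (hmul.congr_fun fun l => ?_).tsum_eq
  simp only [expKernelResidue, nsmul_cuspClass_eq_zero_iff hk hcop, polylogTerm_one, mul_ite,
    mul_one, mul_zero]

omit hx in
theorem polylogTerm_zero_mul_expKernelConst (l : ℕ+) :
    polylogTerm x 0 l * expKernelConst ((l : ℕ) • cuspClass h k) =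
      if k ∣ (l : ℕ) then x ^ (l : ℕ) / l * (-1 / 2) else wTerm x h k l := by
  simp only [polylogTerm_zero, expKernelConst, nsmul_cuspClass_eq_zero_iff hk hcop, mul_ite,
    expKernel_nsmul_cuspClass_zero, wTerm]

theorem summable_wTerm : Summable (fun l : {l : ℕ // ¬ k ∣ l} => wTerm x h k l) := by
  have hpos : ∀ l : {l : ℕ // ¬ k ∣ l}, 0 < (l : ℕ) := fun l =>
    Nat.pos_of_ne_zero fun h0 => l.2 (h0 ▸ dvd_zero k)
  have hinj : Function.Injective fun l : {l : ℕ // ¬ k ∣ l} => (⟨l, hpos l⟩ : ℕ+) :=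
    fun l l' hl => Subtype.ext (congrArg PNat.val hl)
  refine ((summable_polylogTerm_mul_nsmul hx (isOfFinAddOrder_cuspClass hk hcop) 0
    expKernelConst).comp_injective hinj).congr fun l => ?_
  exact (polylogTerm_zero_mul_expKernelConst hk hcop _).trans (if_neg l.2)

theorem tsum_polylogTerm_mul_expKernelConst :
    ∑' l : ℕ+, polylogTerm x 0 l * expKernelConst ((l : ℕ) • cuspClass h k) = wConst x h k := by
  have hlog : HasSum (fun l : ℕ+ => if k ∣ (l : ℕ) then x ^ (l : ℕ) / l * (-1 / 2) else 0)
      (1 / (2 * k) * log (1 - x ^ k)) := by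
    have hlog := (hasSum_pnat_iff_of_apply_zero (by simp)).2
      (hasSum_taylorSeries_neg_log (norm_pow_lt_one hx hk))
    refine hasSum_pnat_of_multiples (g := fun l => x ^ l / l * (-1 / 2)) hk ?_
    convert! hlog.mul_left (-1 / (2 * (k : ℂ))) using 1
    · ext n
      push_cast
      rw [pow_mul]
      ring
    · ring
  have hw : HasSum (fun l : ℕ+ => {l : ℕ | ¬ k ∣ l}.indicator (wTerm x h k) l)
      (∑' l : {l : ℕ // ¬ k ∣ l}, wTerm x h k l) :=
    (hasSum_pnat_iff_of_apply_zero (by simp)).2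
      (hasSum_subtype_iff_indicator.1 (summable_wTerm hk hcop hx).hasSum)
  refine ((hlog.add hw).congr_fun fun l => ?_).tsum_eq
  rw [polylogTerm_zero_mul_expKernelConst hk hcop]
  by_cases hl : k ∣ (l : ℕ) <;> simp [hl]

theorem qFun_cuspClass_zero : qFun x (cuspClass h k) 0 = wConst x h k := by
  rw [qFun_apply_zero, tsum_polylogTerm_mul_expKernelConst hk hcop hx]

theorem tendsto_sub_one_mul_qFun_cuspClass :
    Tendsto (fun s : ℂ => (s - 1) * qFun x (cuspClass h k) s) (𝓝[≠] 1)
      (𝓝 (dilog (x ^ k) / (k : ℂ) ^ 2)) := by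
  rw [← tsum_polylogTerm_mul_expKernelResidue hk hcop hx]
  exact tendsto_sub_one_mul_qFun hx (isOfFinAddOrder_cuspClass hk hcop)

end CuspClass

theorem meromorphicOrderAt_eq_neg_one {f : ℂ → ℂ} {c b : ℂ}
    (hf : ∀ᶠ z in 𝓝[≠] c, DifferentiableAt ℂ f z) (hb : b ≠ 0)
    (h : Tendsto (fun z => (z - c) * f z) (𝓝[≠] c) (𝓝 b)) : meromorphicOrderAt f c = -1 := by
  have hmer := meromorphicAt_of_tendsto_sub_mul hf h
  have hsub : MeromorphicAt (fun z => z - c) c := by fun_prop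
  have horder := (tendsto_ne_zero_iff_meromorphicOrderAt_eq_zero (hsub.mul hmer)).1 ⟨b, hb, h⟩
  rw [meromorphicOrderAt_mul hsub hmer, meromorphicOrderAt_id_sub_const] at horder
  cases hn : meromorphicOrderAt f c with
  | top => simp [hn] at horder
  | coe n =>
    have hn0 : 1 + n = 0 := by exact_mod_cast hn ▸ horder
    exact congrArg _ (eq_neg_of_add_eq_zero_right hn0)

/-! ### The product -/

theorem cuspPoint_pow (h : ℤ) (k : ℕ) (z : ℂ) (l : ℕ) :
    cuspPoint h k z ^ l = (l • cuspClass h k).toCircle * cexp (-(l * (2 * Real.pi * z))) := by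
  rw [toCircle_nsmul_cuspClass, cuspPoint, ← exp_nat_mul, ← exp_add]
  congr 1
  linear_combination 2 * Real.pi * z * l * I_sq

theorem norm_cuspPoint_lt_one (h : ℤ) (k : ℕ) {z : ℂ} (hz : 0 < z.re) :
    ‖cuspPoint h k z‖ < 1 := by
  have hnorm : ‖cuspPoint h k z‖ = Real.exp (-(2 * Real.pi * z).re) := by
    rw [← neg_re, ← norm_exp]
    simpa [Circle.norm_coe] using congrArg norm (cuspPoint_pow h k z 1)
  rw [hnorm, Real.exp_lt_one_iff]
  exact neg_lt_zero.2 (two_pi_mul_re_pos hz)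

theorem hasProd_one_div_one_sub_mul_pow {x u : ℂ} (hx : ‖x‖ < 1) (hu : ‖u‖ < 1) {b : ℂ}
    (hb : HasSum (fun l : ℕ+ => x ^ (l : ℕ) / l * (u ^ (l : ℕ) / (1 - u ^ (l : ℕ)))) b) :
    HasProd (fun j : ℕ+ => 1 / (1 - x * u ^ (j : ℕ))) (cexp b) := by
  have hgeom : ∀ y : ℂ, ‖y‖ < 1 → Summable fun m : ℕ+ => ‖y‖ ^ (m : ℕ) := fun y hy =>
    (hasSum_pnat_geometric (by rwa [norm_norm])).summable
  have hsum : HasSum (fun p : ℕ+ × ℕ+ => (x * u ^ (p.1 : ℕ)) ^ (p.2 : ℕ) / (p.2 : ℂ)) b := by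
    refine hasSum_of_hasSum_columns (hgeom u hu) (hgeom x hx) (fun m l => ?_) (fun l => ?_) hb
    · have hl : (1 : ℝ) ≤ l := by exact_mod_cast l.pos
      rw [norm_div, norm_natCast, norm_pow, norm_mul, norm_pow, mul_pow, ← pow_mul,
        mul_comm (‖x‖ ^ _)]
      refine (div_le_self (by positivity) hl).trans ?_
      gcongr ?_ * _
      exact pow_le_pow_of_le_one (norm_nonneg _) hu.le (Nat.le_mul_of_pos_right _ l.pos)
    · refine ((hasSum_pnat_geometric (norm_pow_lt_one hu l.pos)).mul_left _).congr_fun fun m => ?_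
      rw [mul_pow, ← pow_mul, ← pow_mul, mul_comm (m : ℕ)]
      ring
  have hlt : ∀ m : ℕ+, ‖x * u ^ (m : ℕ)‖ < 1 := fun m => by
    rw [norm_mul]
    exact mul_lt_one_of_nonneg_of_lt_one_left (norm_nonneg _) hx (norm_pow_lt_one hu m.pos).le
  have hlog : HasSum (fun m : ℕ+ => -log (1 - x * u ^ (m : ℕ))) b :=
    hsum.prod_fiberwise fun m => (hasSum_pnat_iff_of_apply_zero (by simp)).2
      (hasSum_taylorSeries_neg_log (hlt m))
  convert! hlog.cexp using 1
  ext m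
  have hne : 1 - x * u ^ (m : ℕ) ≠ 0 := sub_ne_zero.2 fun h => by
    simpa [← h] using hlt m
  rw [Function.comp_apply, exp_neg, exp_log hne, one_div]

theorem hasProd_cuspPoint {h : ℤ} {k : ℕ} (hk : 0 < k) (hcop : IsCoprime h (k : ℤ)) {x : ℂ}
    (hx : ‖x‖ < 1) {σ : ℝ} (hσ : σ ∈ Ioo (-1) 0) {z : ℂ} (hz : 0 < z.re) :
    HasProd (fun j : ℕ+ => 1 / (1 - x * cuspPoint h k z ^ (j : ℕ)))
      (cexp (wConst x h k) * cexp (psiFun x k z) * cexp (1 / (2 * Real.pi * I) *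
        ∫ t : ℝ, jIntegrand (qFun x (cuspClass h k)) z (σ + t * I) * I)) := by
  have hpsi : dilog (x ^ k) / (k : ℂ) ^ 2 / (2 * Real.pi * z) = psiFun x k z := by
    rw [psiFun]
    field_simp
  have hj (f : ℝ → ℂ) :
      1 / (2 * Real.pi) * ∫ t : ℝ, f t = 1 / (2 * Real.pi * I) * ∫ t : ℝ, f t * I := by
    rw [integral_mul_const]
    field_simp
  have hsum := hasSum_pow_div_mul_expKernel hx (isOfFinAddOrder_cuspClass hk hcop) hσ hz
  rw [tsum_polylogTerm_mul_expKernelConst hk hcop hx,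
    tsum_polylogTerm_mul_expKernelResidue hk hcop hx, hpsi, hj] at hsum
  rw [← exp_add, ← exp_add]
  refine hasProd_one_div_one_sub_mul_pow hx (norm_cuspPoint_lt_one h k hz)
    (hsum.congr_fun fun l => ?_)
  rw [expKernel_eq_div, cuspPoint_pow]

theorem mainTheorem6_general (h : ℤ) (k : ℕ) (hk : 0 < k) (hcop : IsCoprime h (k : ℤ)) (x : ℂ)
    (hx : ‖x‖ < 1) :
    Summable (fun l : {l : ℕ // ¬ k ∣ l} => wTerm x h k l) ∧
    ∃ Q : ℂ → ℂ,
      (∀ s : ℂ, 1 < s.re → HasSum (qTerm x h k s) (Q s)) ∧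
      DifferentiableOn ℂ Q {1}ᶜ ∧
      (x ≠ 0 → meromorphicOrderAt Q 1 = -1) ∧
      Tendsto (fun s : ℂ => (s - 1) * Q s) (𝓝[≠] 1) (𝓝 (dilog (x ^ k) / (k : ℂ) ^ 2)) ∧
      Q 0 = wConst x h k ∧
      ∀ σ ∈ Ioo (-1 : ℝ) 0, ∀ z : ℂ, 0 < z.re →
        Multipliable (fun j : ℕ+ => 1 / (1 - x * cuspPoint h k z ^ (j : ℕ))) ∧
        Integrable (fun t : ℝ => jIntegrand Q z (σ + t * I)) ∧
        partitionGF x (cuspPoint h k z) = cexp (wConst x h k) * cexp (psiFun x k z) *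
          cexp (1 / (2 * Real.pi * I) * ∫ t : ℝ, jIntegrand Q z (σ + t * I) * I) := by
  have hfin := isOfFinAddOrder_cuspClass hk hcop
  have hres := tendsto_sub_one_mul_qFun_cuspClass hk hcop hx
  refine ⟨summable_wTerm hk hcop hx, qFun x (cuspClass h k), fun s => hasSum_qTerm hx hk hcop,
    differentiableOn_qFun hx hfin, fun hx0 => ?_, hres, qFun_cuspClass_zero hk hcop hx,
    fun σ hσ z hz => ?_⟩
  · have hdiff : ∀ᶠ s in 𝓝[≠] 1, DifferentiableAt ℂ (qFun x (cuspClass h k)) s :=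
      eventually_mem_nhdsWithin.mono fun s hs =>
        (differentiableOn_qFun hx hfin).differentiableAt (isOpen_compl_singleton.mem_nhds hs)
    have hdilog : dilog (x ^ k) ≠ 0 := dilog_ne_zero (pow_ne_zero k hx0) (norm_pow_lt_one hx hk)
    exact meromorphicOrderAt_eq_neg_one hdiff
      (div_ne_zero hdilog (pow_ne_zero 2 (Nat.cast_ne_zero.2 hk.ne'))) hres
  · have hprod := hasProd_cuspPoint hk hcop hx hσ hz
    exact ⟨hprod.multipliable, integrable_jIntegrand_qFun hx hfin hσ hz, hprod.tprod_eq⟩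

theorem mainTheorem6 (h : ℤ) (k : ℕ) (hk : 0 < k) (hlt : h < (k : ℤ))
    (hcop : IsCoprime h (k : ℤ)) (x : ℂ) (hx : ‖x‖ < 1) :
    Summable (fun l : {l : ℕ // ¬ k ∣ l} => wTerm x h k l) ∧
    ∃ Q : ℂ → ℂ,
      -- `Q` is the analytic continuation of the double series to `ℂ` without the point `1`
      (∀ s : ℂ, 1 < s.re → HasSum (qTerm x h k s) (Q s)) ∧
      DifferentiableOn ℂ Q {1}ᶜ ∧
      -- simple pole at `1` with the stated residue, and the value at `0`
      (x ≠ 0 → meromorphicOrderAt Q 1 = -1) ∧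
      Filter.Tendsto (fun s : ℂ => (s - 1) * Q s) (nhdsWithin 1 {1}ᶜ)
        (nhds (dilog (x ^ k) / (k : ℂ) ^ 2)) ∧
      Q 0 = wConst x h k ∧
      -- the factorization
      ∀ z : ℂ, 0 < z.re →
        Multipliable (fun j : ℕ+ => 1 / (1 - x * cuspPoint h k z ^ (j : ℕ))) ∧
        MeasureTheory.Integrable (fun t : ℝ => jIntegrand Q z (linePoint t)) ∧
        partitionGF x (cuspPoint h k z) =
          Complex.exp (wConst x h k) * Complex.exp (psiFun x k z) * Complex.exp (jFun Q z) := by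
  have hline (t : ℝ) : ((-3 / 4 : ℝ) : ℂ) + t * I = linePoint t := by simp [linePoint]
  obtain ⟨hw, Q, hQ, hdiff, hpole, hres, hzero, hfactor⟩ := mainTheorem6_general h k hk hcop x hx
  simp only [jFun, ← hline]
  exact ⟨hw, Q, hQ, hdiff, hpole, hres, hzero, hfactor (-3 / 4) (by norm_num)⟩
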